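/- A separator of a morphism of schemes $f:T\to S$ is an $S$-morphism $h:T\to E$ to a separated $S$-scheme $E$ which is a surjective, quasi-compact, quasi-separated local isomorphism (every point of $T$ has an open neighbourhood on which $h$ is an open immersion) whose diagonal $\Delta_h:T\to T\times_E T$ is schematically dominant, i.e. $\mathcal O_{T\times_E T}\to(\Delta_h)_*\mathcal O_T$ is injective. A separator of a scheme $T$ is a separator of $T\to\operatorname{Spec}\mathbf Z$. **Proposition.** Let $T$ be a locally Noetherian scheme of dimension $1$ which is regular (all its local rings are regular). Then there is a morphism $h:T\to E$ to a separated scheme $E$ which is a surjective quasi-separated local isomorphism with schematically dominant diagonal. If moreover $T$ is Noetherian, then $T$ admits a separator. -/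

import Mathlib

open CategoryTheory CategoryTheory.Limits AlgebraicGeometry

universe u

namespace SeparatorScheme

/-- A factorization `T ⟶ E ⟶ S` of `f`, by `h` and then `g`, where `E` is separated over `S` and
`h` is a surjective quasi-separated local isomorphism with schematically dominant diagonal.
(The diagonal of `h` is quasi-compact, so that schematic dominance, the vanishing of its
kernel ideal, is injectivity of the map from the structure sheaf of `T ×_E T` to the direct image
of that of `T`.) These are the properties of a separator, quasi-compactness of `h` excepted. -/
structure IsPreseparator {T S E : Scheme.{u}} (f : T ⟶ S) (g : E ⟶ S) (h : T ⟶ E) : Prop where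
  fac : h ≫ g = f
  isSeparated : IsSeparated g
  isLocalIso : IsLocalIso h
  surjective : Surjective h
  quasiSeparated : QuasiSeparated h
  diagonal_dominant : IsSchemeTheoreticallyDominant (pullback.diagonal h)

/-- `h : T ⟶ E` is a separator for `f : T ⟶ S`, where `g : E ⟶ S` is the structure morphism. -/
structure IsSeparator {T S E : Scheme.{u}} (f : T ⟶ S) (g : E ⟶ S) (h : T ⟶ E) : Prop
    extends IsPreseparator f g h where
  quasiCompact : QuasiCompact h

/-- The morphism `f : T ⟶ S` admits a separator. -/
def AdmitsSeparator {T S : Scheme.{u}} (f : T ⟶ S) : Prop :=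
  ∃ (E : Scheme.{u}) (g : E ⟶ S) (h : T ⟶ E), IsSeparator f g h

/-- The structure morphism of `T` to `Spec ℤ`. -/
noncomputable abbrev toSpecInt (T : Scheme.{u}) : T ⟶ Spec (.of (ULift.{u} ℤ)) :=
  specULiftZIsTerminal.from T

/-- A scheme is regular if all its local rings are regular local rings. -/
def IsRegularScheme (T : Scheme.{u}) : Prop :=
  ∀ x : T, IsRegularLocalRing (T.presheaf.stalk x)

end SeparatorScheme

/-! The local rings of `T` are fields or discrete valuation rings. Call two points equivalent when a
common generization `η` has a stalk in which their local rings have the same image. Zorn's lemma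
gives an open `E` maximal among those with no two distinct equivalent points.

`E` is separated: two lifts in the valuative criterion end at points whose local rings, being
valuation rings dominated by one valuation ring, coincide (`localSubring_le_of_lift`). By maximality
every point of `T` is equivalent to a point of `E` (`exists_sameLocalRing_of_maximal`), so `E` is
dense. Equivalent points have isomorphic affine neighbourhoods, compatibly with `η`
(`SameLocalRing.exists_isAffineOpen`). These charts glue to a local isomorphism `h : T ⟶ E`
retracting the inclusion. Density of `E` makes the diagonal of `h` dominant, hence schematically
dominant because `T ×_E T` is reduced. Noetherianity of `T` is needed only for `h` to be
quasi-compact. -/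

namespace SeparatorScheme

open IsLocalRing TopologicalSpace

/-! ### Regular local rings of dimension at most one -/

section Algebra

variable {R : Type*} [CommRing R]

lemma exists_eq_unit_mul_pow [IsLocalRing R] [IsNoetherianRing R] {t : R}
    (ht : maximalIdeal R = Ideal.span {t}) {a : R} (ha : a ≠ 0) :
    ∃ (n : ℕ) (v : R), IsUnit v ∧ a = v * t ^ n := by
  have hex : ∃ n, a ∉ maximalIdeal R ^ n := by
    by_contra! h
    have : a ∈ (⨅ n : ℕ, maximalIdeal R ^ n) := by simpa [Ideal.mem_iInf] using h
    rw [Ideal.iInf_pow_eq_bot_of_isLocalRing _ (IsLocalRing.maximalIdeal.isMaximal R).ne_top] at this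
    exact ha this
  classical
  have h0 : Nat.find hex ≠ 0 := fun h ↦ by
    have := Nat.find_spec hex
    simp [h] at this
  obtain ⟨n, hn⟩ := Nat.exists_eq_succ_of_ne_zero h0
  have h1 : a ∈ maximalIdeal R ^ n := by
    by_contra h
    have := Nat.find_min' hex h
    omega
  have h2 : a ∉ maximalIdeal R ^ (n + 1) := by
    have := Nat.find_spec hex
    rwa [hn] at this
  rw [ht, Ideal.span_singleton_pow, Ideal.mem_span_singleton'] at h1
  obtain ⟨v, rfl⟩ := h1
  refine ⟨n, v, ?_, rfl⟩
  by_contra hv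
  have hv' : v ∈ maximalIdeal R := hv
  refine h2 ?_
  rw [pow_succ']
  refine Ideal.mul_mem_mul hv' (Ideal.pow_mem_pow ?_ n)
  rw [ht]
  exact Ideal.mem_span_singleton_self t

/-- The maximal ideal is zero or generated by one `t`. In the second case the dimension is one, so
`t` is not nilpotent, and nonzero elements, being units times powers of `t`, have nonzero products.
-/
theorem isDomain_and_isPrincipalIdealRing_of_isRegularLocalRing [IsRegularLocalRing R]
    (hdim : ringKrullDim R ≤ 1) : IsDomain R ∧ IsPrincipalIdealRing R := by
  have hfg : (maximalIdeal R).FG := IsNoetherian.noetherian _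
  have hspan := IsRegularLocalRing.spanFinrank_maximalIdeal (R := R)
  have hle : (maximalIdeal R).spanFinrank ≤ 1 := by
    rw [← hspan] at hdim
    exact_mod_cast hdim
  have field_case (hbot : maximalIdeal R = ⊥) : IsDomain R ∧ IsPrincipalIdealRing R := by
    let := (IsLocalRing.isField_iff_maximalIdeal_eq.mpr hbot).toField
    exact ⟨inferInstance, inferInstance⟩
  obtain h0 | h1 : (maximalIdeal R).spanFinrank = 0 ∨ (maximalIdeal R).spanFinrank = 1 := by omega
  · exact field_case ((Submodule.spanFinrank_eq_zero_iff_eq_bot hfg).mp h0)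
  obtain ⟨⟨⟨t, ht⟩⟩, -⟩ := (Submodule.spanFinrank_eq_one_iff _).mp h1
  have ht' : maximalIdeal R = Ideal.span {t} := ht
  have htn (n : ℕ) : t ^ n ≠ 0 := by
    intro h
    have : Ring.KrullDimLE 0 R := by
      rw [Ring.krullDimLE_zero_iff]
      intro P hP
      have htP : t ∈ P := hP.mem_of_pow_mem n (h ▸ P.zero_mem)
      have : maximalIdeal R ≤ P := by
        rw [ht', Ideal.span_singleton_le_iff_mem]
        exact htP
      rw [← (maximalIdeal.isMaximal R).eq_of_le hP.ne_top this]
      exact maximalIdeal.isMaximal R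
    have h2 := (Ring.krullDimLE_iff (n := 0) (R := R)).mp this
    rw [← hspan, h1] at h2
    norm_num at h2
  have hdom : IsDomain R := by
    have : NoZeroDivisors R := by
      refine ⟨fun {a b} hab ↦ ?_⟩
      by_contra! h
      obtain ⟨n, v, hv, rfl⟩ := exists_eq_unit_mul_pow ht' h.1
      obtain ⟨m, w, hw, rfl⟩ := exists_eq_unit_mul_pow ht' h.2
      refine htn (n + m) ((hv.mul hw).mul_left_eq_zero.mp ?_)
      rw [← hab]
      ring
    exact NoZeroDivisors.to_isDomain R
  exact ⟨hdom, ((tfae_of_isNoetherianRing_of_isLocalRing_of_isDomain R).out 0 4).mpr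
    (show (maximalIdeal R).IsPrincipal from ⟨⟨t, ht⟩⟩)⟩

end Algebra

/-- The local rings of `X` are principal ideal domains: fields or discrete valuation rings. -/
class HasPIDStalks (X : Scheme.{u}) : Prop where
  isDomain (x : X) : IsDomain (X.presheaf.stalk x)
  isPrincipalIdealRing (x : X) : IsPrincipalIdealRing (X.presheaf.stalk x)

attribute [instance] HasPIDStalks.isDomain HasPIDStalks.isPrincipalIdealRing

lemma ringKrullDim_stalk_le (X : Scheme.{u}) (x : X) :
    ringKrullDim (X.presheaf.stalk x) ≤ topologicalKrullDim X := by
  rw [← PrimeSpectrum.topologicalKrullDim_eq_ringKrullDim]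
  exact (X.fromSpecStalk x).isEmbedding.isInducing.topologicalKrullDim_le

lemma IsRegularScheme.hasPIDStalks {X : Scheme.{u}} (h : IsRegularScheme X)
    (hdim : topologicalKrullDim X ≤ 1) : HasPIDStalks X := by
  have (x : X) := h x
  have key (x : X) := isDomain_and_isPrincipalIdealRing_of_isRegularLocalRing
    ((ringKrullDim_stalk_le X x).trans hdim)
  exact ⟨fun x ↦ (key x).1, fun x ↦ (key x).2⟩

instance HasPIDStalks.isReduced (X : Scheme.{u}) [HasPIDStalks X] : IsReduced X := by
  have (x : X) : _root_.IsReduced (X.presheaf.stalk x) := inferInstance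
  exact isReduced_of_isReduced_stalk X

/-- A point with no proper generization. -/
def IsMaxPoint {X : Type*} [TopologicalSpace X] (η : X) : Prop := ∀ z, z ⤳ η → z = η

/-! ### Components and generic points -/

section Topology

variable {X : Scheme.{u}} [HasPIDStalks X]

lemma exists_isMaxPoint_specializes (x : X) :
    ∃ η : X, η ⤳ x ∧ IsMaxPoint η ∧ ∀ y, y ⤳ x → η ⤳ y ∧ (y = x ∨ y = η) := by
  let b : Spec (X.presheaf.stalk x) := (⊥ : PrimeSpectrum (X.presheaf.stalk x))
  let η := X.fromSpecStalk x b
  have hrange := Scheme.range_fromSpecStalk (X := X) (x := x)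
  have hηx : η ⤳ x := by
    have : η ∈ Set.range (X.fromSpecStalk x) := ⟨b, rfl⟩
    rwa [hrange] at this
  have key (y : X) (hy : y ⤳ x) : η ⤳ y ∧ (y = x ∨ y = η) := by
    have : y ∈ Set.range (X.fromSpecStalk x) := by rwa [hrange]
    obtain ⟨p, rfl⟩ := this
    have hbp : b ⤳ p := (PrimeSpectrum.le_iff_specializes _ _).mp bot_le
    refine ⟨hbp.map (X.fromSpecStalk x).continuous, ?_⟩
    by_cases hp : p.asIdeal = ⊥
    · right
      have : p = b := PrimeSpectrum.ext hp
      rw [this]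
    · left
      have hmax : p.asIdeal.IsMaximal := p.isPrime.isMaximal hp
      have : p = closedPoint (X.presheaf.stalk x) :=
        PrimeSpectrum.ext (IsLocalRing.eq_maximalIdeal hmax)
      rw [this]
      exact Scheme.fromSpecStalk_closedPoint
  refine ⟨η, hηx, fun z hz ↦ ?_, key⟩
  exact (hz.antisymm (key z (hz.trans hηx)).1).eq

lemma IsMaxPoint.eq_of_specializes {η ξ x : X} (hη : IsMaxPoint η) (hξ : IsMaxPoint ξ)
    (h : η ⤳ x) (h' : ξ ⤳ x) : η = ξ := by
  obtain ⟨ζ, -, -, h2⟩ := exists_isMaxPoint_specializes x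
  rw [← hη _ (h2 _ h).1, ← hξ _ (h2 _ h').1]

lemma eq_or_isMaxPoint_of_specializes {x y : X} (h : y ⤳ x) : y = x ∨ IsMaxPoint y := by
  obtain ⟨ζ, -, h1, h2⟩ := exists_isMaxPoint_specializes x
  obtain h3 | rfl := (h2 _ h).2
  · exact .inl h3
  · exact .inr h1

lemma IsMaxPoint.specializes_of_specializes {η ξ x : X} (hη : IsMaxPoint η)
    (h : η ⤳ x) (h' : ξ ⤳ x) : η ⤳ ξ := by
  obtain ⟨ζ, -, -, h2⟩ := exists_isMaxPoint_specializes x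
  rw [← hη _ (h2 _ h).1]
  exact (h2 _ h').1

/-- Components are locally finite, and only one passes through a given point; discarding the
finitely many that miss `x` leaves a neighbourhood inside the closure of `η`. -/
lemma isOpen_closure_singleton_of_isMaxPoint [IsLocallyNoetherian X] {η : X} (hη : IsMaxPoint η) :
    IsOpen (closure {η}) := by
  rw [isOpen_iff_mem_nhds]
  intro x hx
  have hx' : η ⤳ x := specializes_iff_mem_closure.mpr hx
  obtain ⟨_, ⟨U, hU, rfl⟩, hxU, -⟩ :=
    X.isBasis_affineOpens.exists_subset_of_mem_open (Set.mem_univ x) isOpen_univ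
  have : IsNoetherianRing Γ(X, U) := IsLocallyNoetherian.component_noetherian ⟨U, hU⟩
  have : NoetherianSpace U := noetherianSpace_of_isAffineOpen U hU
  have hfin := NoetherianSpace.finite_irreducibleComponents (α := U)
  let F : Set (Set U) := {Z ∈ irreducibleComponents U | ⟨x, hxU⟩ ∉ Z}
  have hF : F.Finite := hfin.subset (Set.sep_subset _ _)
  have hcl : IsClosed (⋃₀ F) := by
    rw [Set.sUnion_eq_biUnion]
    exact hF.isClosed_biUnion fun Z hZ ↦ isClosed_of_mem_irreducibleComponents Z hZ.1
  have hN : IsOpen (Subtype.val '' (⋃₀ F)ᶜ) := U.2.isOpenMap_subtype_val _ hcl.isOpen_compl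
  refine Filter.mem_of_superset (hN.mem_nhds ⟨⟨x, hxU⟩, ?_, rfl⟩) ?_
  · rintro ⟨Z, hZ, hxZ⟩
    exact hZ.2 hxZ
  · rintro _ ⟨⟨y, hyU⟩, hy, rfl⟩
    have hyZ : (⟨y, hyU⟩ : U) ∈ irreducibleComponent (⟨y, hyU⟩ : U) := mem_irreducibleComponent
    have hxZ : (⟨x, hxU⟩ : U) ∈ irreducibleComponent (⟨y, hyU⟩ : U) := by
      by_contra h
      exact hy ⟨_, ⟨irreducibleComponent_mem_irreducibleComponents _, h⟩, hyZ⟩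
    have : QuasiSober (U : Set X) := U.2.isOpenEmbedding_subtypeVal.quasiSober
    obtain ⟨g, hg⟩ := this.sober (isIrreducible_irreducibleComponent (x := (⟨y, hyU⟩ : U)))
      isClosed_irreducibleComponent
    have hgx : g.1 ⤳ x := (hg.specializes hxZ).map continuous_subtype_val
    have hgy : g.1 ⤳ y := (hg.specializes hyZ).map continuous_subtype_val
    exact ((hη.specializes_of_specializes hx' hgx).trans hgy).mem_closure

/-- A point `y` has an open neighbourhood all of whose other points lie in a given neighbourhood
of the generic point of its component. -/
lemma exists_opens_mem_and_le_insert [IsLocallyNoetherian X] {η y : X} (hy : η ⤳ y)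
    (hη : IsMaxPoint η) (W : X.Opens) (hW : η ∈ W) :
    ∃ N : X.Opens, y ∈ N ∧ ∀ z ∈ N, z = y ∨ z ∈ W := by
  obtain ⟨_, ⟨V, hV, rfl⟩, hyV, -⟩ :=
    X.isBasis_affineOpens.exists_subset_of_mem_open (Set.mem_univ y) isOpen_univ
  have : IsNoetherianRing Γ(X, V) := IsLocallyNoetherian.component_noetherian ⟨V, hV⟩
  have : NoetherianSpace V := noetherianSpace_of_isAffineOpen V hV
  have : QuasiSober V := V.2.isOpenEmbedding_subtypeVal.quasiSober
  let Z : Set V := {v | η ⤳ v.1 ∧ v.1 ∉ W}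
  -- Points of `Z` differ from `η`, so they have no proper specializations; a Noetherian space then
  -- leaves only finitely many.
  have hpt (v : V) (hv : v ∈ Z) (w : V) (h : v ⤳ w) : w = v := by
    obtain h1 | h1 := eq_or_isMaxPoint_of_specializes (h.map continuous_subtype_val)
    · exact (Subtype.ext h1).symm
    · exact absurd (h1 _ hv.1 ▸ hW) hv.2
  have hZ : IsClosed Z := by
    have : Z = Subtype.val ⁻¹' (closure {η} ∩ (W : Set X)ᶜ) := by
      ext v
      exact and_congr_left' specializes_iff_mem_closure
    rw [this]
    exact (isClosed_closure.inter W.2.isClosed_compl).preimage continuous_subtype_val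
  have hfin : Z.Finite := by
    obtain ⟨S, hS, hcl, hirr, hsup⟩ := NoetherianSpace.exists_finite_set_isClosed_irreducible hZ
    have hsub (t : Set V) (ht : t ∈ S) : ∃ v : V, t = {v} := by
      have htZ : t ⊆ Z := hsup ▸ Set.subset_sUnion_of_mem ht
      obtain ⟨v, hv⟩ := this.sober (hirr t ht) (hcl t ht)
      exact ⟨v, Set.Subset.antisymm (fun w hw ↦ hpt v (htZ hv.mem) w (hv.specializes hw))
        (Set.singleton_subset_iff.mpr hv.mem)⟩
    rw [hsup]
    refine hS.sUnion fun t ht ↦ ?_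
    obtain ⟨v, rfl⟩ := hsub t ht
    exact Set.finite_singleton v
  have hcl : IsClosed (Z \ {⟨y, hyV⟩}) := by
    rw [← Set.biUnion_of_singleton (Z \ {⟨y, hyV⟩})]
    refine (hfin.subset Set.sdiff_subset).isClosed_biUnion fun v hv ↦ ?_
    rw [← closure_subset_iff_isClosed]
    exact fun w hw ↦ hpt v hv.1 w (specializes_iff_mem_closure.mpr hw)
  have hC := isOpen_closure_singleton_of_isMaxPoint hη
  refine ⟨⟨Subtype.val '' (Z \ {⟨y, hyV⟩})ᶜ ∩ closure {η},
    (V.2.isOpenMap_subtype_val _ hcl.isOpen_compl).inter hC⟩, ⟨⟨⟨y, hyV⟩, fun h ↦ h.2 rfl, rfl⟩,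
    hy.mem_closure⟩, ?_⟩
  rintro _ ⟨⟨v, hv, rfl⟩, hv'⟩
  by_contra! h
  exact hv ⟨⟨specializes_iff_mem_closure.mpr hv', h.2⟩, fun h' ↦ h.1 (congrArg Subtype.val h')⟩

end Topology

/-! ### Local rings inside the stalk at a generization -/

section Stalks

variable {X : Scheme.{u}}

lemma stalkSpecializes_germ_apply {η x : X} (h : η ⤳ x) {U : X.Opens} (hx : x ∈ U)
    (s : Γ(X, U)) : X.presheaf.stalkSpecializes h (X.presheaf.germ U x hx s) =
      X.presheaf.germ U η (h.mem_open U.2 hx) s :=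
  ConcreteCategory.congr_hom (X.presheaf.germ_stalkSpecializes hx h) s

lemma exists_mul_germ_eq_germ {U : X.Opens} (hU : IsAffineOpen U) {x : X} (hx : x ∈ U)
    (a : X.presheaf.stalk x) : ∃ s t : Γ(X, U), IsUnit (X.presheaf.germ U x hx t) ∧
      a * X.presheaf.germ U x hx t = X.presheaf.germ U x hx s := by
  let := X.presheaf.algebra_section_stalk ⟨x, hx⟩
  have := hU.isLocalization_stalk ⟨x, hx⟩
  obtain ⟨⟨s, t⟩, hst⟩ := IsLocalization.surj (hU.primeIdealOf ⟨x, hx⟩).asIdeal.primeCompl a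
  exact ⟨s, t, IsLocalization.map_units (X.presheaf.stalk x) t, hst⟩

lemma exists_isUnit_germ_mul_eq_zero {U : X.Opens} (hU : IsAffineOpen U) {x : X} (hx : x ∈ U)
    {s : Γ(X, U)} (hs : X.presheaf.germ U x hx s = 0) :
    ∃ r : Γ(X, U), IsUnit (X.presheaf.germ U x hx r) ∧ r * s = 0 := by
  let := X.presheaf.algebra_section_stalk ⟨x, hx⟩
  have := hU.isLocalization_stalk ⟨x, hx⟩
  obtain ⟨r, hr⟩ := (IsLocalization.map_eq_zero_iff
    (hU.primeIdealOf ⟨x, hx⟩).asIdeal.primeCompl (X.presheaf.stalk x) s).mp hs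
  exact ⟨r, IsLocalization.map_units (X.presheaf.stalk x) r, hr⟩

lemma stalkSpecializes_injective [HasPIDStalks X] {η x : X} (h : η ⤳ x) :
    Function.Injective (X.presheaf.stalkSpecializes h) := by
  refine (injective_iff_map_eq_zero (X.presheaf.stalkSpecializes h).hom).mpr fun a ha ↦ ?_
  obtain ⟨_, ⟨U, hU, rfl⟩, hx, -⟩ :=
    X.isBasis_affineOpens.exists_subset_of_mem_open (Set.mem_univ x) isOpen_univ
  obtain ⟨s, t, ht, hst⟩ := exists_mul_germ_eq_germ hU hx a
  have hs : X.presheaf.germ U η (h.mem_open U.2 hx) s = 0 := by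
    rw [← stalkSpecializes_germ_apply h hx, ← hst, map_mul]
    exact mul_eq_zero_of_left ha _
  obtain ⟨r, hr, hrs⟩ := exists_isUnit_germ_mul_eq_zero hU _ hs
  have h0 : X.presheaf.germ U x hx r * X.presheaf.germ U x hx s = 0 := by
    rw [← map_mul, hrs, map_zero]
  obtain h1 | h1 := mul_eq_zero.mp h0
  · refine absurd hr ?_
    rw [← stalkSpecializes_germ_apply h hx, h1, map_zero]
    exact not_isUnit_zero
  · rw [h1] at hst
    exact ht.mul_left_eq_zero.mp hst

/-- The local ring at `x`, as a subring of the local ring at a generization `η`. -/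
noncomputable def localSubring {η x : X} (h : η ⤳ x) : Subring (X.presheaf.stalk η) :=
  (X.presheaf.stalkSpecializes h).hom.range

lemma germ_mem_localSubring {η x : X} (h : η ⤳ x) {U : X.Opens} (hη : η ∈ U) (hx : x ∈ U)
    (s : Γ(X, U)) : X.presheaf.germ U η hη s ∈ localSubring h :=
  ⟨_, stalkSpecializes_germ_apply h hx s⟩

/-- Two points have a common generization with the same local subring. -/
def SameLocalRing (x y : X) : Prop :=
  ∃ (η : X) (hx : η ⤳ x) (hy : η ⤳ y), localSubring hx = localSubring hy

variable [HasPIDStalks X]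

lemma mem_basicOpen_iff_exists_inverse {η x : X} (h : η ⤳ x) {U : X.Opens} (hη : η ∈ U)
    (hx : x ∈ U) (f : Γ(X, U)) :
    x ∈ X.basicOpen f ↔ ∃ g ∈ localSubring h, g * X.presheaf.germ U η hη f = 1 := by
  rw [X.mem_basicOpen f x hx, isUnit_iff_exists_inv']
  constructor
  · rintro ⟨g, hg⟩
    refine ⟨_, ⟨g, rfl⟩, ?_⟩
    have := congrArg (X.presheaf.stalkSpecializes h) hg
    rwa [map_mul, stalkSpecializes_germ_apply, map_one] at this
  · rintro ⟨_, ⟨g, rfl⟩, hg⟩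
    refine ⟨g, stalkSpecializes_injective h ?_⟩
    rwa [map_mul, stalkSpecializes_germ_apply, map_one]

/-- Whether a point lies in a basic open depends only on its local subring, and basic opens separate
points of an affine open. -/
lemma SameLocalRing.eq_of_isAffineOpen {x y : X} (h : SameLocalRing x y) {U : X.Opens}
    (hU : IsAffineOpen U) (hx : x ∈ U) (hy : y ∈ U) : x = y := by
  obtain ⟨η, hηx, hηy, h⟩ := h
  have hη := hηx.mem_open U.2 hx
  have key (f : Γ(X, U)) : x ∈ X.basicOpen f ↔ y ∈ X.basicOpen f := by
    rw [mem_basicOpen_iff_exists_inverse hηx hη hx, mem_basicOpen_iff_exists_inverse hηy hη hy, h]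
  have key' (W : X.Opens) : x ∈ W ↔ y ∈ W := by
    constructor
    · intro hW
      obtain ⟨f, hf, hxf⟩ := hU.exists_basicOpen_le (V := W) ⟨x, hW⟩ hx
      exact hf ((key f).mp hxf)
    · intro hW
      obtain ⟨f, hf, hxf⟩ := hU.exists_basicOpen_le (V := W) ⟨y, hW⟩ hy
      exact hf ((key f).mpr hxf)
  exact (inseparable_iff_forall_isOpen.mpr fun s hs ↦ key' ⟨s, hs⟩).eq

lemma germ_injective_of_forall_specializes {η : X} {U : X.Opens} (hη : η ∈ U)
    (hU : ∀ u ∈ U, η ⤳ u) : Function.Injective (X.presheaf.germ U η hη) := by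
  intro s t hst
  refine TopCat.Presheaf.section_ext X.sheaf U s t fun u hu ↦ stalkSpecializes_injective (hU u hu) ?_
  exact ((stalkSpecializes_germ_apply (hU u hu) hu s).trans hst).trans
    (stalkSpecializes_germ_apply (hU u hu) hu t).symm

/-- Local sections with germ `f` at `η` agree on overlaps, since sections there are determined by
that germ. Thus the sections over `U` are the intersection of its local subrings. -/
lemma exists_germ_eq_of_forall_mem_localSubring {η : X} {U : X.Opens} (hη : η ∈ U)
    (hU : ∀ u ∈ U, η ⤳ u) {f : X.presheaf.stalk η}
    (hf : ∀ u (hu : u ∈ U), f ∈ localSubring (hU u hu)) :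
    ∃ s : Γ(X, U), X.presheaf.germ U η hη s = f := by
  have hloc (u : U) : ∃ (V : X.Opens) (_ : u.1 ∈ V) (i : V ⟶ U) (hηV : η ∈ V) (s : Γ(X, V)),
      X.presheaf.germ V η hηV s = f := by
    obtain ⟨a, ha⟩ := hf u u.2
    obtain ⟨V, hVU, hV, s, rfl⟩ := X.presheaf.exists_le_germ_eq a u.2
    exact ⟨V, hV, homOfLE hVU, (hU u u.2).mem_open V.2 hV, s,
      (stalkSpecializes_germ_apply (hU u u.2) hV s).symm.trans ha⟩
  choose V hV i hηV s hs using hloc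
  obtain ⟨t, ht, -⟩ := X.sheaf.existsUnique_gluing' V U i
    (fun u hu ↦ Opens.mem_iSup.mpr ⟨⟨u, hu⟩, hV ⟨u, hu⟩⟩) s (by
      intro u v
      have hW : η ∈ V u ⊓ V v := ⟨hηV u, hηV v⟩
      apply germ_injective_of_forall_specializes hW fun w hw ↦ hU w ((i u).le hw.1)
      exact (TopCat.Presheaf.germ_res_apply X.presheaf _ η hW _).trans
        ((hs u).trans ((hs v).symm.trans
          (TopCat.Presheaf.germ_res_apply X.presheaf _ η hW _).symm)))
  refine ⟨t, ?_⟩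
  rw [← hs ⟨η, hη⟩, ← ht ⟨η, hη⟩]
  exact (TopCat.Presheaf.germ_res_apply X.presheaf (i ⟨η, hη⟩) η _ t).symm

end Stalks

lemma exists_ringEquiv_of_range_eq {A B K : Type*} [CommRing A] [CommRing B] [CommRing K]
    {f : A →+* K} {g : B →+* K} (hf : Function.Injective f) (hg : Function.Injective g)
    (h : f.range = g.range) : ∃ e : A ≃+* B, ∀ a, g (e a) = f a := by
  let ef : A ≃+* f.range := RingEquiv.ofBijective f.rangeRestrict
    ⟨fun a b hab ↦ hf (congrArg Subtype.val hab), f.rangeRestrict_surjective⟩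
  let eg : B ≃+* g.range := RingEquiv.ofBijective g.rangeRestrict
    ⟨fun a b hab ↦ hg (congrArg Subtype.val hab), g.rangeRestrict_surjective⟩
  refine ⟨(ef.trans (RingEquiv.subringCongr h)).trans eg.symm, fun a ↦ ?_⟩
  exact congrArg Subtype.val (eg.apply_symm_apply (RingEquiv.subringCongr h (ef a)))

/-! ### Isomorphic neighbourhoods of equivalent points -/

section Charts

variable {X : Scheme.{u}}

lemma exists_isAffineOpen_mem_and_subset {x : X} (U : X.Opens) (hx : x ∈ U) :
    ∃ V : X.Opens, IsAffineOpen V ∧ x ∈ V ∧ V ≤ U := by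
  obtain ⟨_, ⟨V, hV, rfl⟩, hxV, hVU⟩ := X.isBasis_affineOpens.exists_subset_of_mem_open hx U.2
  exact ⟨V, hV, hxV, hVU⟩

variable [HasPIDStalks X]

lemma SameLocalRing.exists_isMaxPoint {x y : X} (h : SameLocalRing x y) :
    ∃ (η : X) (hx : η ⤳ x) (hy : η ⤳ y), IsMaxPoint η ∧ localSubring hx = localSubring hy := by
  obtain ⟨η, hx, hy, h⟩ := h
  by_cases hη : IsMaxPoint η
  · exact ⟨η, hx, hy, hη, h⟩
  obtain rfl := (eq_or_isMaxPoint_of_specializes hx).resolve_right hη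
  obtain rfl := (eq_or_isMaxPoint_of_specializes hy).resolve_right hη
  obtain ⟨ξ, hξ, hm, -⟩ := exists_isMaxPoint_specializes η
  exact ⟨ξ, hξ, hξ, hm, rfl⟩

variable [IsLocallyNoetherian X]

/-- The points of `X` that specialize a given maximal point. -/
def component {η : X} (hη : IsMaxPoint η) : X.Opens :=
  ⟨closure {η}, isOpen_closure_singleton_of_isMaxPoint hη⟩

lemma mem_component_iff {η x : X} (hη : IsMaxPoint η) : x ∈ component hη ↔ η ⤳ x :=
  specializes_iff_mem_closure.symm

lemma SameLocalRing.exists_isAffineOpen {x y : X} (h : SameLocalRing x y) (E : X.Opens)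
    (hxE : x ∈ E) : ∃ (U V : X.Opens) (η : X) (hηU : η ∈ U) (hηV : η ∈ V)
      (e : Γ(X, U) ≃+* Γ(X, V)), IsAffineOpen U ∧ IsAffineOpen V ∧ U ≤ E ∧ y ∈ V ∧
      (∀ v ∈ V, η ⤳ v) ∧ ∀ s, X.presheaf.germ V η hηV (e s) = X.presheaf.germ U η hηU s := by
  obtain ⟨η, hηx, hηy, hη, hxy⟩ := h.exists_isMaxPoint
  obtain ⟨U, hU, hxU, hUE⟩ := exists_isAffineOpen_mem_and_subset (E ⊓ component hη)
    ⟨hxE, (mem_component_iff hη).mpr hηx⟩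
  obtain ⟨N, hyN, hN⟩ := exists_opens_mem_and_le_insert hηy hη U (hηx.mem_open U.2 hxU)
  obtain ⟨V, hV, hyV, hVN⟩ := exists_isAffineOpen_mem_and_subset (N ⊓ component hη)
    ⟨hyN, (mem_component_iff hη).mpr hηy⟩
  obtain ⟨M, hxM, hM⟩ := exists_opens_mem_and_le_insert hηx hη V (hηy.mem_open V.2 hyV)
  have hηU := hηx.mem_open U.2 hxU
  have hηV := hηy.mem_open V.2 hyV
  have hspU (u) (hu : u ∈ U) : η ⤳ u := (mem_component_iff hη).mp (hUE hu).2
  have hspV (v) (hv : v ∈ V) : η ⤳ v := (mem_component_iff hη).mp (hVN hv).2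
  -- Shrink to basic opens of `f` and of the section `g` with the same germ at `η`. Apart from `x`
  -- and `y` they have the same points, so their rings are the same intersection of local subrings.
  obtain ⟨f, hfM, hxf⟩ := hU.exists_basicOpen_le (V := M) ⟨x, hxM⟩ hxU
  obtain ⟨g, hg⟩ := exists_germ_eq_of_forall_mem_localSubring (f := X.presheaf.germ U η hηU f)
    hηV hspV (fun v hv ↦ by
      obtain rfl | hvU := hN v (hVN hv).1
      · rw [← hxy]
        exact germ_mem_localSubring hηx hηU hxU f
      · exact germ_mem_localSubring _ hηU hvU f)
  have hfg (z : X) (hzU : z ∈ U) (hzV : z ∈ V) : z ∈ X.basicOpen f ↔ z ∈ X.basicOpen g := by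
    rw [mem_basicOpen_iff_exists_inverse (hspU z hzU) hηU hzU,
      mem_basicOpen_iff_exists_inverse (hspU z hzU) hηV hzV, hg]
  have hyg : y ∈ X.basicOpen g := by
    rw [mem_basicOpen_iff_exists_inverse hηx hηU hxU] at hxf
    rwa [mem_basicOpen_iff_exists_inverse hηy hηV hyV, hg, ← hxy]
  have hspf (u) (hu : u ∈ X.basicOpen f) : η ⤳ u := hspU u (X.basicOpen_le f hu)
  have hspg (v) (hv : v ∈ X.basicOpen g) : η ⤳ v := hspV v (X.basicOpen_le g hv)
  have hηf := hηx.mem_open (X.basicOpen f).2 hxf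
  have hηg := hηy.mem_open (X.basicOpen g).2 hyg
  have hrange : (X.presheaf.germ (X.basicOpen f) η hηf).hom.range =
      (X.presheaf.germ (X.basicOpen g) η hηg).hom.range := by
    ext a
    constructor
    · rintro ⟨s, rfl⟩
      refine exists_germ_eq_of_forall_mem_localSubring hηg hspg fun v hv ↦ ?_
      obtain rfl | hvU := hN v (hVN (X.basicOpen_le g hv)).1
      · rw [← hxy]
        exact germ_mem_localSubring hηx hηf hxf s
      · exact germ_mem_localSubring _ hηf ((hfg v hvU (X.basicOpen_le g hv)).mpr hv) s
    · rintro ⟨s, rfl⟩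
      refine exists_germ_eq_of_forall_mem_localSubring hηf hspf fun u hu ↦ ?_
      obtain rfl | huV := hM u (hfM hu)
      · rw [hxy]
        exact germ_mem_localSubring hηy hηg hyg s
      · exact germ_mem_localSubring _ hηg ((hfg u (X.basicOpen_le f hu) huV).mp hu) s
  obtain ⟨e, he⟩ := exists_ringEquiv_of_range_eq
    (germ_injective_of_forall_specializes hηf hspf)
    (germ_injective_of_forall_specializes hηg hspg) hrange
  exact ⟨X.basicOpen f, X.basicOpen g, η, hηf, hηg, e, hU.basicOpen f, hV.basicOpen g,
    (X.basicOpen_le f).trans (hUE.trans inf_le_left), hyg, hspg, he⟩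

lemma SameLocalRing.exists_isOpenImmersion {x y : X} (h : SameLocalRing x y) (E : X.Opens)
    (hxE : x ∈ E) : ∃ (V : X.Opens) (q : Spec Γ(X, V) ⟶ E) (η : X)
      (hη : η ∈ V), IsAffineOpen V ∧ y ∈ V ∧ IsOpenImmersion q ∧ (∀ v ∈ V, η ⤳ v) ∧
      Spec.map (X.presheaf.germ V η hη) ≫ q ≫ E.ι = X.fromSpecStalk η := by
  obtain ⟨U, V, η, hηU, hηV, e, hU, hV, hUE, hyV, hsp, he⟩ := h.exists_isAffineOpen E hxE
  let φ : Γ(X, U) ≅ Γ(X, V) := e.toCommRingCatIso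
  have hrange : Set.range (Spec.map φ.hom ≫ hU.fromSpec) ⊆ Set.range E.ι := by
    rw [Scheme.Opens.range_ι]
    rintro _ ⟨z, rfl⟩
    rw [Scheme.Hom.comp_apply]
    exact hUE (hU.range_fromSpec.subset ⟨_, rfl⟩)
  have hq := IsOpenImmersion.lift_fac E.ι (Spec.map φ.hom ≫ hU.fromSpec) hrange
  refine ⟨V, IsOpenImmersion.lift E.ι (Spec.map φ.hom ≫ hU.fromSpec) hrange, η, hηV, hV, hyV, ?_,
    hsp, ?_⟩
  · have : IsOpenImmersion (IsOpenImmersion.lift E.ι (Spec.map φ.hom ≫ hU.fromSpec) hrange ≫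
        E.ι) := by
      rw [hq]
      infer_instance
    exact IsOpenImmersion.of_comp _ E.ι
  · have hφ : φ.hom ≫ X.presheaf.germ V η hηV = X.presheaf.germ U η hηU := by
      ext s
      exact he s
    rw [hq, ← Spec.map_comp_assoc, hφ, ← hU.fromSpecStalk_eq_fromSpecStalk hηU,
      IsAffineOpen.fromSpecStalk]

end Charts

/-! ### The valuative criterion -/

section Separated

variable {X : Scheme.{u}} {R K : CommRingCat.{u}} [IsLocalRing R] [IsLocalRing K] {j : R ⟶ K}
  {i : Spec K ⟶ X} {l l₁ l₂ : Spec R ⟶ X}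

lemma closedPoint_specializes_closedPoint (h : Spec.map j ≫ l = i) :
    i (closedPoint K) ⤳ l (closedPoint R) := by
  subst h
  exact (IsLocalRing.specializes_closedPoint _).map l.continuous

lemma stalkSpecializes_comp_stalkClosedPointTo (h : Spec.map j ≫ l = i)
    (hs : i (closedPoint K) ⤳ l (closedPoint R)) :
    X.presheaf.stalkSpecializes hs ≫ Scheme.stalkClosedPointTo i =
      Scheme.stalkClosedPointTo l ≫ j := by
  refine Spec.map_injective ?_
  rw [← cancel_mono (X.fromSpecStalk _), Spec.map_comp, Spec.map_comp, Category.assoc,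
    Category.assoc, Scheme.SpecMap_stalkSpecializes_fromSpecStalk,
    Scheme.Spec_stalkClosedPointTo_fromSpecStalk, Scheme.Spec_stalkClosedPointTo_fromSpecStalk, h]

lemma eq_of_closedPoint_eq (hj : Function.Injective j) (h₁ : Spec.map j ≫ l₁ = i)
    (h₂ : Spec.map j ≫ l₂ = i)
    (h : l₁ (closedPoint R) = l₂ (closedPoint R)) : l₁ = l₂ := by
  have hs₁ := closedPoint_specializes_closedPoint h₁
  have hs₂ := closedPoint_specializes_closedPoint h₂
  have e₁ := stalkSpecializes_comp_stalkClosedPointTo h₁ hs₁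
  have e₂ := stalkSpecializes_comp_stalkClosedPointTo h₂ hs₂
  rw [← Scheme.Spec_stalkClosedPointTo_fromSpecStalk l₁,
    ← Scheme.Spec_stalkClosedPointTo_fromSpecStalk l₂]
  generalize Scheme.stalkClosedPointTo l₁ = a at *
  generalize Scheme.stalkClosedPointTo l₂ = b at *
  clear h₁ h₂
  revert hs₁ hs₂
  generalize l₁ (closedPoint R) = x at *
  subst h
  intro hs₁ hs₂ e₁ e₂
  have : a = b := by
    ext c
    apply hj
    exact ConcreteCategory.congr_hom (e₁.symm.trans e₂) c
  rw [this]

variable [HasPIDStalks X]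

lemma localSubring_le_of_lift (hj : Function.Injective j) (h₁ : Spec.map j ≫ l₁ = i)
    (h₂ : Spec.map j ≫ l₂ = i)
    (hs₁ : i (closedPoint K) ⤳ l₁ (closedPoint R)) (hs₂ : i (closedPoint K) ⤳ l₂ (closedPoint R)) :
    localSubring hs₁ ≤ localSubring hs₂ := by
  rintro _ ⟨a, rfl⟩
  have e₁ (b) := ConcreteCategory.congr_hom (stalkSpecializes_comp_stalkClosedPointTo h₁ hs₁) b
  have e₂ (b) := ConcreteCategory.congr_hom (stalkSpecializes_comp_stalkClosedPointTo h₂ hs₂) b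
  obtain ⟨U, hU, hx, -⟩ := exists_isAffineOpen_mem_and_subset ⊤
    (show l₂ (closedPoint R) ∈ (⊤ : X.Opens) from trivial)
  obtain ⟨s, t, ht, hst⟩ := exists_mul_germ_eq_germ hU (hs₂.mem_open U.2 hx)
    (X.presheaf.stalkSpecializes hs₁ a)
  have hs' := stalkSpecializes_germ_apply hs₂ hx s
  have ht' := stalkSpecializes_germ_apply hs₂ hx t
  rw [← hs', ← ht'] at hst
  rw [← ht'] at ht
  generalize X.presheaf.germ U _ hx s = s' at *
  generalize X.presheaf.germ U _ hx t = t' at *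
  -- Either `a` already comes from the stalk at the second point, or its inverse `c` does. In the
  -- latter case `c` becomes a unit in `R`, and locality of the map to `R` makes `c` itself a unit.
  obtain ⟨c, rfl⟩ | ⟨c, rfl⟩ := ValuationRing.dvd_total t' s'
  · refine ⟨c, ?_⟩
    rw [map_mul, mul_comm] at hst
    exact (ht.mul_left_cancel hst).symm
  · rw [map_mul] at ht hst
    have hs := isUnit_of_mul_isUnit_left ht
    have hac : X.presheaf.stalkSpecializes hs₁ a * X.presheaf.stalkSpecializes hs₂ c = 1 := by
      refine hs.mul_left_cancel ?_
      rw [mul_one]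
      nth_rw 2 [← hst]
      ring
    have hR : Scheme.stalkClosedPointTo l₁ a * Scheme.stalkClosedPointTo l₂ c = 1 := by
      apply hj
      have := congrArg (Scheme.stalkClosedPointTo i) hac
      rw [map_mul, map_one] at this
      rw [map_mul, map_one, ← this]
      exact congrArg₂ _ (e₁ a).symm (e₂ c).symm
    have hc : IsUnit c := isUnit_of_map_unit (Scheme.stalkClosedPointTo l₂).hom c
      (IsUnit.of_mul_eq_one_right _ hR)
    obtain ⟨d, hd⟩ := hc.exists_right_inv
    refine ⟨d, ?_⟩
    have hd' := congrArg (X.presheaf.stalkSpecializes hs₂) hd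
    rw [map_mul, map_one] at hd'
    exact (left_inv_eq_right_inv hac hd').symm

theorem isSeparated_of_sameLocalRing_imp_eq [IsLocallyNoetherian X] (E : X.Opens)
    (hE : ∀ x ∈ E, ∀ y ∈ E, SameLocalRing x y → x = y) {S : Scheme.{u}} (g : E.toScheme ⟶ S) :
    IsSeparated g := by
  apply IsSeparated.of_valuativeCriterion
  rintro ⟨R, K, i₁, i₂, sq⟩
  refine ⟨fun l₁ l₂ ↦ CommSq.LiftStruct.ext ?_⟩
  have h₁ : Spec.map (CommRingCat.ofHom (algebraMap R K)) ≫ l₁.l ≫ E.ι = i₁ ≫ E.ι := by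
    rw [← Category.assoc, l₁.fac_left]
  have h₂ : Spec.map (CommRingCat.ofHom (algebraMap R K)) ≫ l₂.l ≫ E.ι = i₁ ≫ E.ι := by
    rw [← Category.assoc, l₂.fac_left]
  have hj : Function.Injective (CommRingCat.ofHom (algebraMap R K)) := IsFractionRing.injective R K
  have : IsLocalRing (CommRingCat.of R) := inferInstanceAs (IsLocalRing R)
  have : IsLocalRing (CommRingCat.of K) := inferInstanceAs (IsLocalRing K)
  have hs₁ := closedPoint_specializes_closedPoint h₁
  have hs₂ := closedPoint_specializes_closedPoint h₂
  rw [← cancel_mono E.ι]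
  refine eq_of_closedPoint_eq hj h₁ h₂ (hE _ ?_ _ ?_ ⟨_, hs₁, hs₂, le_antisymm
    (localSubring_le_of_lift hj h₁ h₂ _ _) (localSubring_le_of_lift hj h₂ h₁ _ _)⟩)
  · exact (l₁.l (closedPoint R)).2
  · exact (l₂.l (closedPoint R)).2

end Separated

/-! ### A maximal open without equivalent points -/

section Maximal

variable {X : Scheme.{u}}

lemma SameLocalRing.refl (x : X) : SameLocalRing x x := ⟨x, specializes_rfl, specializes_rfl, rfl⟩

lemma SameLocalRing.symm {x y : X} (h : SameLocalRing x y) : SameLocalRing y x := by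
  obtain ⟨η, hx, hy, h⟩ := h
  exact ⟨η, hy, hx, h.symm⟩

/-- Distinct points of `E` have distinct local rings. -/
def HasDistinctLocalRings (E : X.Opens) : Prop :=
  ∀ x ∈ E, ∀ y ∈ E, SameLocalRing x y → x = y

lemma exists_maximal_hasDistinctLocalRings (X : Scheme.{u}) :
    ∃ E : X.Opens, Maximal HasDistinctLocalRings E := by
  refine zorn_le₀ {E : X.Opens | HasDistinctLocalRings E} fun c hc hchain ↦
    ⟨sSup c, ?_, fun U hU ↦ le_sSup hU⟩
  intro x hx y hy hxy
  obtain ⟨U, hU, hxU⟩ := Opens.mem_sSup.mp hx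
  obtain ⟨V, hV, hyV⟩ := Opens.mem_sSup.mp hy
  obtain h | h := hchain.total hU hV
  · exact hc hV x (h hxU) y hyV hxy
  · exact hc hU x hxU y (h hyV) hxy

variable [HasPIDStalks X] [IsLocallyNoetherian X]

lemma exists_sameLocalRing_of_maximal {E : X.Opens} (hE : Maximal HasDistinctLocalRings E)
    (y : X) : ∃ x ∈ E, SameLocalRing x y := by
  by_contra! hy
  suffices ∃ N : X.Opens, y ∈ N ∧ HasDistinctLocalRings (E ⊔ N) by
    obtain ⟨N, hyN, hN⟩ := this
    exact hy y (hE.2 hN le_sup_left (Opens.mem_sup.mpr (.inr hyN))) (.refl y)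
  obtain ⟨η, hηy, hη, -⟩ := exists_isMaxPoint_specializes y
  -- If `η` is in `E`, a small neighbourhood adds only `y`. Otherwise `E` misses the whole
  -- component, and any affine neighbourhood of `y` in it can be added.
  by_cases hηE : η ∈ E
  · obtain ⟨N, hyN, hN⟩ := exists_opens_mem_and_le_insert hηy hη E hηE
    refine ⟨N, hyN, ?_⟩
    have hmem (z : X) (hz : z ∈ E ⊔ N) : z = y ∨ z ∈ E :=
      (Opens.mem_sup.mp hz).elim .inr (hN z)
    intro a ha b hb hab
    obtain rfl | ha := hmem a ha <;> obtain rfl | hb := hmem b hb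
    · rfl
    · exact absurd hab.symm (hy b hb)
    · exact absurd hab (hy a ha)
    · exact hE.1 a ha b hb hab
  · obtain ⟨V, hV, hyV, hVη⟩ := exists_isAffineOpen_mem_and_subset (component hη)
      ((mem_component_iff hη).mpr hηy)
    have hdisj (a : X) (ha : a ∈ E) (b : X) (hb : b ∈ V) : ¬ SameLocalRing a b := by
      intro hab
      obtain ⟨ξ, hξa, hξb, hξ, -⟩ := hab.exists_isMaxPoint
      obtain rfl := hη.eq_of_specializes hξ ((mem_component_iff hη).mp (hVη hb)) hξb
      exact hηE (hξa.mem_open E.2 ha)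
    refine ⟨V, hyV, fun a ha b hb hab ↦ ?_⟩
    obtain ha | ha := Opens.mem_sup.mp ha <;> obtain hb | hb := Opens.mem_sup.mp hb
    · exact hE.1 a ha b hb hab
    · exact absurd hab (hdisj a ha b hb)
    · exact absurd hab.symm (hdisj b hb a ha)
    · exact hab.eq_of_isAffineOpen hV ha hb

end Maximal

/-! ### Schematic dominance of the diagonal -/

section Dominant

lemma isDominant_pullback_fst_of_isOpenMap {X Y Z : Scheme.{u}} (f : X ⟶ Z) (g : Y ⟶ Z)
    (hf : IsOpenMap f) [IsDominant g] : IsDominant (pullback.fst f g) := by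
  refine ⟨?_⟩
  rw [DenseRange, Scheme.Pullback.range_fst]
  exact g.denseRange.preimage hf

instance : MorphismProperty.ContainsIdentities @IsLocalIso.{u} :=
  (inferInstance : MorphismProperty.IsMultiplicative @IsLocalIso.{u}).toContainsIdentities

instance : MorphismProperty.ContainsIdentities @UniversallyOpen.{u} :=
  (inferInstance : MorphismProperty.IsMultiplicative @UniversallyOpen.{u}).toContainsIdentities

lemma isOpenMap_of_isLocalIso {X Y : Scheme.{u}} (f : X ⟶ Y) [hf : IsLocalIso f] : IsOpenMap f := by
  have : UniversallyOpen f := IsLocalIso.le_of_isZariskiLocalAtSource @UniversallyOpen _ _ f hf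
  exact f.isOpenMap

lemma isReduced_of_isLocalIso {X Y : Scheme.{u}} (f : X ⟶ Y) [IsLocalIso f] [IsReduced Y] :
    IsReduced X := by
  choose U hxU hU using IsLocalIso.exists_isOpenImmersion (f := f)
  let 𝒰 := X.openCoverOfIsOpenCover U
    (eq_top_iff.mpr fun x _ ↦ Opens.mem_iSup.mpr ⟨x, hxU x⟩)
  rw [IsReduced.iff_of_openCover X 𝒰]
  intro x
  exact @isReduced_of_isOpenImmersion _ _ _ (hU x) _

/-- A local isomorphism with a dominant section has schematically dominant diagonal. -/
theorem isSchemeTheoreticallyDominant_diagonal_of_section {X E : Scheme.{u}} [IsReduced X]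
    (h : X ⟶ E) (s : E ⟶ X) [IsLocalIso h] [IsOpenImmersion s] [IsDominant s] (hs : s ≫ h = 𝟙 E) :
    IsSchemeTheoreticallyDominant (pullback.diagonal h) := by
  have hfst : IsLocalIso (pullback.fst h h) :=
    MorphismProperty.of_isPullback (P := @IsLocalIso) (.flip (.of_hasPullback h h)) inferInstance
  have hsnd : IsLocalIso (pullback.snd h h) :=
    MorphismProperty.of_isPullback (P := @IsLocalIso) (.of_hasPullback h h) inferInstance
  have : IsReduced (pullback h h) := isReduced_of_isLocalIso (pullback.fst h h)
  let p₁ := pullback.fst (pullback.fst h h) s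
  have : IsDominant p₁ := isDominant_pullback_fst_of_isOpenMap _ _ (isOpenMap_of_isLocalIso _)
  have ho : IsOpenMap (p₁ ≫ pullback.snd h h) := by
    rw [Scheme.Hom.comp_base]
    exact (isOpenMap_of_isLocalIso (pullback.snd h h)).comp p₁.isOpenEmbedding.isOpenMap
  let p₂ := pullback.fst (p₁ ≫ pullback.snd h h) s
  have : IsDominant p₂ := isDominant_pullback_fst_of_isOpenMap _ _ ho
  -- On the dense open where both projections land in the image of `s`, they agree because `h`
  -- retracts `s`; this open therefore factors through the diagonal.
  have key : (p₂ ≫ p₁ ≫ pullback.fst h h) ≫ pullback.diagonal h = p₂ ≫ p₁ := by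
    have h₁ : p₁ ≫ pullback.fst h h = pullback.snd _ _ ≫ s := pullback.condition
    have h₂ : p₂ ≫ p₁ ≫ pullback.snd h h = pullback.snd _ _ ≫ s := pullback.condition
    have h₃ : p₂ ≫ pullback.snd (pullback.fst h h) s = pullback.snd _ _ := by
      have e₁ : (p₂ ≫ p₁ ≫ pullback.fst h h) ≫ h = p₂ ≫ pullback.snd (pullback.fst h h) s := by
        rw [h₁, Category.assoc, Category.assoc, hs, Category.comp_id]
      have e₂ : (p₂ ≫ p₁ ≫ pullback.snd h h) ≫ h = pullback.snd _ _ := by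
        rw [h₂, Category.assoc, hs, Category.comp_id]
      rw [← e₁, ← e₂]
      simp only [Category.assoc, pullback.condition]
    have h₄ : p₂ ≫ p₁ ≫ pullback.fst h h = p₂ ≫ p₁ ≫ pullback.snd h h := by
      rw [h₁, h₂, ← h₃, Category.assoc]
    apply pullback.hom_ext
    · simp
    · simp [h₄]
  have : IsDominant ((p₂ ≫ p₁ ≫ pullback.fst h h) ≫ pullback.diagonal h) := by
    rw [key]
    infer_instance
  have : IsDominant (pullback.diagonal h) := IsDominant.of_comp (p₂ ≫ p₁ ≫ pullback.fst h h) _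
  exact .of_isDominant _

end Dominant

/-! ### Gluing the retraction -/

section Retraction

/-- Gluing local extensions of the identity of a dense open subscheme. -/
theorem exists_isLocalIso_retraction {X E : Scheme.{u}} [IsReduced X] [E.IsSeparated] (s : E ⟶ X)
    [IsOpenImmersion s] [IsDominant s]
    (H : ∀ x : X, ∃ (W : Scheme.{u}) (j : W ⟶ X) (q : W ⟶ E), IsOpenImmersion j ∧
      x ∈ Set.range j ∧ IsOpenImmersion q ∧ pullback.fst j s ≫ q = pullback.snd j s) :
    ∃ h : X ⟶ E, IsLocalIso h ∧ s ≫ h = 𝟙 E := by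
  choose W j q hj hx hq hjq using H
  let 𝒰 : X.OpenCover :=
    { I₀ := X
      X := W
      f := j
      mem₀ := by
        rw [Scheme.presieve₀_mem_precoverage_iff]
        exact ⟨fun x ↦ ⟨x, hx x⟩, hj⟩ }
  have lift (x : X) {Z : Scheme.{u}} (a : Z ⟶ W x) (b : Z ⟶ E) (hab : a ≫ j x = b ≫ s) :
      a ≫ q x = b := by
    rw [← pullback.lift_fst a b hab, Category.assoc, hjq, pullback.lift_snd]
  -- The overlap is reduced, `E` is separated, and both maps are the identity on the trace of `E`,
  -- which is dense in the overlap.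
  have compat (x y : X) : pullback.fst (j x) (j y) ≫ q x = pullback.snd (j x) (j y) ≫ q y := by
    let k := pullback.fst (j x) (j y) ≫ j x
    have : IsReduced (pullback (j x) (j y)) := isReduced_of_isOpenImmersion k
    have : IsDominant (pullback.fst k s) :=
      isDominant_pullback_fst_of_isOpenMap _ _ k.isOpenEmbedding.isOpenMap
    refine ext_of_isDominant (pullback.fst k s) ?_
    have hk : pullback.fst k s ≫ k = pullback.snd k s ≫ s := pullback.condition
    rw [← Category.assoc, ← Category.assoc, lift x _ (pullback.snd k s),
      lift y _ (pullback.snd k s)]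
    · rw [Category.assoc, ← pullback.condition, hk]
    · rw [Category.assoc, hk]
  let h : X ⟶ E := 𝒰.glueMorphisms q compat
  have hh (x : X) : j x ≫ h = q x := 𝒰.ι_glueMorphisms q compat x
  refine ⟨h, ?_, ?_⟩
  · rw [IsZariskiLocalAtSource.iff_of_openCover (P := @IsLocalIso) 𝒰]
    intro x
    change IsLocalIso (j x ≫ h)
    rw [hh]
    exact IsZariskiLocalAtSource.of_isOpenImmersion (P := @IsLocalIso) (q x)
  · refine Scheme.Cover.hom_ext (𝒰.pullback₁ s) _ _ fun x ↦ ?_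
    change pullback.fst s (j x) ≫ s ≫ h = pullback.fst s (j x) ≫ 𝟙 E
    rw [pullback.condition_assoc, Category.comp_id]
    exact (congrArg (pullback.snd s (j x) ≫ ·) (hh x)).trans (lift x _ _ pullback.condition.symm)

variable {X : Scheme.{u}} [HasPIDStalks X]

/-- The two maps agree on the spectrum of the stalk at `η`, which is dense in the reduced scheme `V
∩ E`, and `E` is separated. -/
lemma pullback_fst_comp_eq_snd {E : X.Opens} [E.toScheme.IsSeparated] {V : X.Opens}
    (hV : IsAffineOpen V) (q : Spec Γ(X, V) ⟶ E) {η : X} (hη : η ∈ V) (hηE : η ∈ E)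
    (hsp : ∀ v ∈ V, η ⤳ v)
    (hq : Spec.map (X.presheaf.germ V η hη) ≫ q ≫ E.ι = X.fromSpecStalk η) :
    pullback.fst hV.fromSpec E.ι ≫ q = pullback.snd hV.fromSpec E.ι := by
  have hfac : Spec.map (X.presheaf.germ V η hη) ≫ hV.fromSpec =
      E.fromSpecStalkOfMem η hηE ≫ E.ι := by
    rw [Scheme.Opens.fromSpecStalkOfMem_ι, ← hV.fromSpecStalk_eq_fromSpecStalk hη,
      IsAffineOpen.fromSpecStalk]
  let k := pullback.fst hV.fromSpec E.ι ≫ hV.fromSpec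
  let d : Spec (X.presheaf.stalk η) ⟶ pullback hV.fromSpec E.ι := pullback.lift _ _ hfac
  have hdk : d ≫ k = X.fromSpecStalk η := by
    rw [pullback.lift_fst_assoc, hfac, Scheme.Opens.fromSpecStalkOfMem_ι]
  have : IsReduced (pullback hV.fromSpec E.ι) := isReduced_of_isOpenImmersion k
  have : IsDominant d := by
    refine ⟨fun p ↦ ?_⟩
    have hp : η ⤳ k p := by
      refine hsp _ (hV.range_fromSpec.subset ?_)
      rw [Scheme.Hom.comp_apply]
      exact ⟨_, rfl⟩
    let c : Spec (X.presheaf.stalk η) := IsLocalRing.closedPoint (X.presheaf.stalk η)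
    have hc : k (d c) = η := by
      rw [← Scheme.Hom.comp_apply, hdk]
      exact Scheme.fromSpecStalk_closedPoint
    have hcp : d c ⤳ p := by
      rw [← k.isOpenEmbedding.isInducing.specializes_iff, hc]
      exact hp
    exact closure_mono (Set.singleton_subset_iff.mpr (Set.mem_range_self c)) hcp.mem_closure
  refine ext_of_isDominant d ?_
  rw [pullback.lift_fst_assoc, pullback.lift_snd, ← cancel_mono E.ι, Category.assoc, hq,
    Scheme.Opens.fromSpecStalkOfMem_ι]

theorem exists_isPreseparator (X : Scheme.{u}) [HasPIDStalks X] [IsLocallyNoetherian X] :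
    ∃ (E : Scheme.{u}) (g : E ⟶ Spec (.of (ULift.{u} ℤ))) (h : X ⟶ E),
      IsPreseparator (toSpecInt X) g h := by
  obtain ⟨E, hE⟩ := exists_maximal_hasDistinctLocalRings X
  have hsep : IsSeparated (terminal.from E.toScheme) :=
    isSeparated_of_sameLocalRing_imp_eq E hE.1 _
  have : E.toScheme.IsSeparated := ⟨hsep⟩
  have hdense : Dense (X := X) E := by
    intro y
    obtain ⟨x, hx, η, hηx, hηy, -⟩ := exists_sameLocalRing_of_maximal hE y
    exact closure_mono (Set.singleton_subset_iff.mpr (hηx.mem_open E.2 hx)) hηy.mem_closure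
  have : IsDominant E.ι := Opens.isDominant_ι hdense
  obtain ⟨h, hloc, hh⟩ := exists_isLocalIso_retraction E.ι fun y ↦ by
    obtain ⟨x, hxE, hxy⟩ := exists_sameLocalRing_of_maximal hE y
    obtain ⟨V, q, η, hη, hV, hyV, hq, hsp, hqη⟩ := hxy.exists_isOpenImmersion E hxE
    have hηE : η ∈ E := by
      obtain ⟨v, hvV, hvE⟩ := hdense.inter_open_nonempty V V.2 ⟨y, hyV⟩
      exact (hsp v hvV).mem_open E.2 hvE
    exact ⟨_, hV.fromSpec, q, inferInstance, hV.range_fromSpec.superset hyV, hq,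
      pullback_fst_comp_eq_snd hV q hη hηE hsp hqη⟩
  refine ⟨E, toSpecInt E, h, ?_⟩
  exact
    { fac := specULiftZIsTerminal.hom_ext _ _
      isSeparated := isSeparated_of_sameLocalRing_imp_eq E hE.1 _
      isLocalIso := hloc
      surjective := ⟨fun e ↦ ⟨E.ι e, by rw [← Scheme.Hom.comp_apply, hh]; rfl⟩⟩
      quasiSeparated := inferInstance
      diagonal_dominant := isSchemeTheoreticallyDominant_diagonal_of_section h E.ι hh }

end Retraction

end SeparatorScheme

theorem mainTheorem4 (T : Scheme.{u}) [IsLocallyNoetherian T]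
    (hreg : SeparatorScheme.IsRegularScheme T) (hdim : topologicalKrullDim T = 1) :
    (∃ (E : Scheme.{u}) (g : E ⟶ Spec (.of (ULift.{u} ℤ))) (h : T ⟶ E),
      SeparatorScheme.IsPreseparator (SeparatorScheme.toSpecInt T) g h) ∧
    (AlgebraicGeometry.IsNoetherian T →
      SeparatorScheme.AdmitsSeparator (SeparatorScheme.toSpecInt T)) := by
  have := hreg.hasPIDStalks hdim.le
  obtain ⟨E, g, h, H⟩ := SeparatorScheme.exists_isPreseparator T
  exact ⟨⟨E, g, h, H⟩, fun _ ↦ ⟨E, g, h, { H with quasiCompact := inferInstance }⟩⟩
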